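/- Let $X$ be a random variable with values in $[0,\infty)$ such that the function $h(x)=1/\mathbb P(X>x)$, $x\ge 0$, is regularly varying at $+\infty$ with index $\alpha>0$. For $N\ge 1$ put $c_N=h^{-1}(2N\log_2 N)$, where $h^{-1}(y)=\inf\{x\ge 0: h(x)>y\}$ is the generalised inverse of $h$. For $N\ge1$ let $(X_{n,k})_{n\ge 0,\,1\le k\le 2N}$ be i.i.d. copies of $X$. The $N$-branching random walk ($N$-BRW) is the sequence of $N$-tuples $\mathcal X_1(n)\le\dots\le\mathcal X_N(n)$, $n\ge0$, with $\mathcal X_i(0)=0$ for all $i$, for which $\mathcal X_1(n+1)\le\dots\le \mathcal X_N(n+1)$ are the $N$ largest (with multiplicity) of the $2N$ numbers $\mathcal X_i(n)+X_{n,2i-1}$, $\mathcal X_i(n)+X_{n,2i}$, $1\le i\le N$. When $c_N>0$ (which holds for all large $N$), put $Y_{n,k}=X_{n,k}/c_N$ and $\mathcal Y_i(n)=\mathcal X_i(n)/c_N$. For $n\ge1$ let $\mathcal F_n$ be the $\sigma$-algebra generated by the variables $Y_{j,k}$ with $0\le j\le n-1$ and $1\le k\le 2N$, and let $\mathcal F_n$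 be trivial for $n\le 0$. For an integer $m\ge1$ the $(N,m)$-discretised stairs process is defined by $R^{N,m}(n)=0$ for $n\le0$ and $$R^{N,m}(n+1)=\max\Bigl\{R^{N,m}(n),\ \max_{1\le k\le 2N}\bigl(R^{N,m}(n-m)+Y_{n,k}\bigr)\Bigr\},\qquad n\ge0.$$ Finally let $$\theta_n=\theta_n^{N,m}=\max_{0\le k\le n}\bigl(\mathcal Y_N(k)-R^{N,m}(k)\bigr),\qquad n\ge0.$$ **Proposition.** For every $\varepsilon>0$ there is $N_0$, depending only on $\varepsilon$ and the law of $X$, such that for all $N\ge N_0$, all integers $m$ with $\tfrac12\log_2N\le m\le 2\log_2N$, all real $x\ge m^{\max(1,1/\alpha)+\varepsilon}/c_N$ and all $n\ge0$, almost surely $$\mathbb P\bigl(\theta_{n+1}-\theta_n>x\,\big|\,\mathcal F_{n-m}\bigr)\le \frac{N\,m\,2^{m+1}}{h(c_Nx)^2}.$$ -/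

import Mathlib

open MeasureTheory ProbabilityTheory Filter Topology
open scoped ENNReal

namespace NBRW

noncomputable section

/-- `f` is regularly varying at `+∞` with index `ρ`: it is measurable, eventually positive, and
`f (t * x) / f x → t ^ ρ` as `x → ∞`, for every `t > 0`. -/
def RegularlyVarying (f : ℝ → ℝ) (ρ : ℝ) : Prop :=
  Measurable f ∧ (∀ᶠ x in atTop, 0 < f x) ∧
    ∀ t : ℝ, 0 < t → Tendsto (fun x => f (t * x) / f x) atTop (𝓝 (t ^ ρ))

/-- The function `h` with `P(X > x) = 1 / h x`, where `ν` is the law of `X`. -/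
def tailInv (ν : Measure ℝ) (x : ℝ) : ℝ := 1 / ν.real (Set.Ioi x)

/-- The generalised inverse of a function on `[0, ∞)`. -/
def genInv (f : ℝ → ℝ) (y : ℝ) : ℝ := sInf {x : ℝ | 0 ≤ x ∧ y < f x}

/-- The space scale `c_N = h⁻¹(2 N log₂ N)`. -/
def scale (ν : Measure ℝ) (N : ℕ) : ℝ := genInv (tailInv ν) (2 * N * Real.logb 2 N)

/-- The parent of the `k`-th of `2N` children: particle `i` has the children `2i` and `2i + 1`
(all labels start from `0`). -/
def parent {N : ℕ} (k : Fin (2 * N)) : Fin N := ⟨(k : ℕ) / 2, by omega⟩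

/-- The `N` largest among `2N` real numbers (with multiplicity), in ascending order. -/
def largest {N : ℕ} (g : Fin (2 * N) → ℝ) (i : Fin N) : ℝ :=
  g (Tuple.sort g ⟨N + (i : ℕ), by omega⟩)

/-- The `N`-BRW driven by the jumps `ξ n k`: `brw ξ n` lists the positions of the `N` particles at
time `n`, in ascending order. -/
def brw {N : ℕ} (ξ : ℕ → Fin (2 * N) → ℝ) : ℕ → Fin N → ℝ
  | 0 => fun _ => 0
  | n + 1 => largest fun k => brw ξ n (parent k) + ξ n k

/-- The position of the right-most particle of the `N`-BRW at time `n`. -/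
def brwMax {N : ℕ} (ξ : ℕ → Fin (2 * N) → ℝ) (n : ℕ) : ℝ := ⨆ i : Fin N, brw ξ n i

/-- The discretised stairs process with delay `ℓ` driven by the jumps `η n k`: it vanishes at all
times `n ≤ 0`, and `R (n + 1) = max (R n) (max_k (R (n - ℓ) + η n k))` for `n ≥ 0`
(see `dsp_of_nonpos` and `dsp_succ`). -/
def dsp {N : ℕ} (η : ℕ → Fin (2 * N) → ℝ) (ℓ : ℕ) (n : ℤ) : ℝ :=
  if n ≤ 0 then 0
  else max (dsp η ℓ (n - 1)) (⨆ k : Fin (2 * N), (dsp η ℓ (n - 1 - ℓ) + η (n - 1).toNat k))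
termination_by n.toNat
decreasing_by all_goals omega

/-- The process `θ_n = max_{0 ≤ k ≤ n} (𝒴_N(k) - R^{N,ℓ}(k))`, built from the jumps `ξ n k` of the
`N`-BRW and the space scale `c`; here `𝒴_N = 𝒳_N / c`, and the discretised stairs process
`R^{N,ℓ}` is driven by the rescaled jumps `ξ n k / c`. -/
def theta {N : ℕ} (c : ℝ) (ξ : ℕ → Fin (2 * N) → ℝ) (ℓ : ℕ) (n : ℕ) : ℝ :=
  (Finset.range (n + 1)).sup' Finset.nonempty_range_add_one fun k =>
    c⁻¹ * brwMax ξ k - dsp (fun j i => c⁻¹ * ξ j i) ℓ k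

/-- The sigma-algebra `ℱ_n` generated by the rescaled jumps `Y_{k,i}` with `0 ≤ k ≤ n - 1`; it is
trivial for `n ≤ 0`. -/
@[reducible]
def history {Ω : Type*} {N : ℕ} (Y : ℕ → Fin (2 * N) → Ω → ℝ) (n : ℤ) : MeasurableSpace Ω :=
  ⨆ (k : ℕ) (_ : (k : ℤ) ≤ n - 1) (i : Fin (2 * N)), MeasurableSpace.comap (Y k i) inferInstance

theorem brw_monotone {N : ℕ} (ξ : ℕ → Fin (2 * N) → ℝ) (n : ℕ) : Monotone (brw ξ n) := by
  intro i j hij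
  cases n with
  | zero => simp [brw]
  | succ n =>
    exact Tuple.monotone_sort (fun k => brw ξ n (parent k) + ξ n k)
      (show (⟨N + (i : ℕ), by omega⟩ : Fin (2 * N)) ≤ ⟨N + (j : ℕ), by omega⟩ from by
        have h : (i : ℕ) ≤ j := hij
        simp only [Fin.mk_le_mk]; omega)

theorem brwMax_eq_last {N : ℕ} (hN : 0 < N) (ξ : ℕ → Fin (2 * N) → ℝ) (n : ℕ) :
    brwMax ξ n = brw ξ n ⟨N - 1, by omega⟩ := by
  have : Nonempty (Fin N) := ⟨⟨0, hN⟩⟩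
  refine le_antisymm (ciSup_le fun i => brw_monotone ξ n ?_)
    (le_ciSup (Set.finite_range (brw ξ n)).bddAbove _)
  have := i.2
  rw [Fin.le_def]
  simp only
  omega

theorem dsp_of_nonpos {N : ℕ} (η : ℕ → Fin (2 * N) → ℝ) (ℓ : ℕ) {n : ℤ} (hn : n ≤ 0) :
    dsp η ℓ n = 0 := by
  rw [dsp, if_pos hn]

theorem dsp_succ {N : ℕ} (η : ℕ → Fin (2 * N) → ℝ) (ℓ n : ℕ) :
    dsp η ℓ ((n : ℤ) + 1) =
      max (dsp η ℓ n) (⨆ k : Fin (2 * N), (dsp η ℓ ((n : ℤ) - ℓ) + η n k)) := by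
  rw [dsp, if_neg (by omega)]
  simp

theorem theta_zero {N : ℕ} (c : ℝ) (ξ : ℕ → Fin (2 * N) → ℝ) (ℓ : ℕ) : theta c ξ ℓ 0 = 0 := by
  simp [theta, brwMax, brw, dsp_of_nonpos]

theorem history_le {Ω : Type*} [MeasurableSpace Ω] {N : ℕ} {Y : ℕ → Fin (2 * N) → Ω → ℝ}
    (hY : ∀ k i, Measurable (Y k i)) (n : ℤ) : history Y n ≤ ‹MeasurableSpace Ω› :=
  iSup_le fun k => iSup_le fun _ => iSup_le fun i => (hY k i).comap_le

theorem history_of_nonpos {Ω : Type*} {N : ℕ} (Y : ℕ → Fin (2 * N) → Ω → ℝ) {n : ℤ}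
    (hn : n ≤ 0) : history Y n = ⊥ := by
  refine le_bot_iff.1 (iSup_le fun k => iSup_le fun hk => ?_)
  omega

end

end NBRW

/-! An increase `θ (n + 1) - θ n > x` forces two large displacements in the `N`-BRW
(`exists_two_displacements`). Let a particle make the jump `z` at time `n` to become the leader at
time `n + 1`. By definition of `θ n`, its parent was at rescaled height at most `θ n + R n`, and
`R (n + 1) ≥ R n`, so the rescaled jump exceeds `x`. Moreover `R (n + 1) ≥ R (n - m) + z / c` and
every particle at time `n - m` was at rescaled height at most `θ n + R (n - m)`, so the parent has
climbed by more than `c x` above the front of time `n - m`.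

Put `X = c x`. The last jump is independent of the past, so the conditional probability is at most
`2 P(jump > X)` times the conditional expectation of the number of particles at time `n` that have
climbed by `X` during the last `m` steps. This number is at most the sum of the weights (`weight`,
`min_one_exp_le_weight`) that start from `exp (-l X)`, are reset to `1` by jumps larger than `b`,
and are multiplied by `exp (l z⁺)` at other jumps. As selection only discards particles, and at
most `N` of them are present at any time, the expected sum is at most
`N (2 M) ^ m (exp (-l X) + 2 P(jump > b))`, where `M ≥ 1` bounds the mean multiplier
(`lintegral_sum_weight_le`). The contributions of the `m` steps at which a jump larger than `b`
may occur form a geometric sum, so no factor `m` is lost, and the factor `m` of the claim is left to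
absorb all the constants.

It remains to choose `l = A log X / X` and `b = δ X` (`RegularlyVarying.exists_tilt`). For `A > α`
the term `exp (-l X) = X ^ (-A)` is negligible against `P(jump > X)`, and `P(jump > b)` is
comparable with it by regular variation. Since `m ≤ X ^ (1 / (max 1 α⁻¹ + ε))`, a moment of order
`p < min 1 α` with `p > 1 / (max 1 α⁻¹ + ε)`, finite by `RegularlyVarying.lintegral_rpow_lt_top`,
gives `M ≤ 1 + 1 / m` when `δ` is small, hence `M ^ m ≤ 3`.
-/

namespace NBRW

/-! ### Genealogies -/

/-- The label, among the `2N` jumps made at time `n`, of the jump that led to the `i`-th lowest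
particle at time `n + 1`. -/
noncomputable def origin {N : ℕ} (ξ : ℕ → Fin (2 * N) → ℝ) (n : ℕ) (i : Fin N) : Fin (2 * N) :=
  Tuple.sort (fun k => brw ξ n (parent k) + ξ n k) ⟨N + (i : ℕ), by omega⟩

theorem brw_succ {N : ℕ} (ξ : ℕ → Fin (2 * N) → ℝ) (n : ℕ) (i : Fin N) :
    brw ξ (n + 1) i = brw ξ n (parent (origin ξ n i)) + ξ n (origin ξ n i) := rfl

theorem origin_injective {N : ℕ} (ξ : ℕ → Fin (2 * N) → ℝ) (n : ℕ) :
    Function.Injective (origin ξ n) := by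
  intro i j hij
  have h := (Tuple.sort fun k => brw ξ n (parent k) + ξ n k).injective hij
  simp only [Fin.mk.injEq] at h
  exact Fin.ext (by omega)

theorem brw_le_brwMax {N : ℕ} (ξ : ℕ → Fin (2 * N) → ℝ) (n : ℕ) (i : Fin N) :
    brw ξ n i ≤ brwMax ξ n :=
  le_ciSup (Set.finite_range (brw ξ n)).bddAbove i

theorem sum_comp_parent {N : ℕ} {M : Type*} [AddCommMonoid M] (f : Fin N → M) :
    ∑ k : Fin (2 * N), f (parent k) = 2 • ∑ i, f i := by
  have h : ∀ p : Fin N × Fin 2,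
      parent ((finProdFinEquiv.trans (finCongr (mul_comm N 2))) p) = p.1 := by
    rintro ⟨i, j⟩
    refine Fin.ext ?_
    simp only [parent, Equiv.trans_apply, finProdFinEquiv_apply_val, finCongr_apply,
      Fin.val_cast]
    omega
  rw [← (finProdFinEquiv.trans (finCongr (mul_comm N 2))).sum_comp, Fintype.sum_prod_type]
  simp only [h, Finset.sum_const, Finset.card_univ, Fintype.card_fin]
  exact Finset.sum_nsmul _ _ _

theorem le_theta {N : ℕ} (c : ℝ) (ξ : ℕ → Fin (2 * N) → ℝ) (ℓ : ℕ) {j n : ℕ} (hj : j ≤ n) :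
    c⁻¹ * brwMax ξ j - dsp (fun j i => c⁻¹ * ξ j i) ℓ j ≤ theta c ξ ℓ n :=
  Finset.le_sup' (fun k : ℕ => c⁻¹ * brwMax ξ k - dsp (fun j i => c⁻¹ * ξ j i) ℓ k)
    (Finset.mem_range_succ_iff.2 hj)

theorem theta_succ {N : ℕ} (c : ℝ) (ξ : ℕ → Fin (2 * N) → ℝ) (ℓ n : ℕ) :
    theta c ξ ℓ (n + 1) = max (theta c ξ ℓ n)
      (c⁻¹ * brwMax ξ (n + 1) - dsp (fun j i => c⁻¹ * ξ j i) ℓ ((n : ℤ) + 1)) := by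
  refine le_antisymm (Finset.sup'_le _ _ fun k hk => ?_)
    (max_le (Finset.sup'_le _ _ fun k hk => le_theta c ξ ℓ ?_) ?_)
  · rcases (Finset.mem_range_succ_iff.1 hk).lt_or_eq with h | rfl
    · exact le_max_of_le_left (le_theta c ξ ℓ (Nat.lt_succ_iff.1 h))
    · exact le_max_of_le_right (by push_cast; rfl)
  · exact (Finset.mem_range_succ_iff.1 hk).trans n.le_succ
  · have := le_theta c ξ ℓ (le_refl (n + 1))
    push_cast at this
    exact this

/-- An increase of `θ` by more than `x` forces two large displacements: the last jump
of the leader exceeds `x`, and its parent has climbed by more than `x` above the front during the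
preceding `ℓ` steps. The first is the definition of `θ_n` at time `n`, the second is the same
definition at time `n - ℓ` combined with `R(n + 1) ≥ R(n - ℓ) + Y_{n,k}`. -/
theorem exists_two_displacements {N : ℕ} (hN : 0 < N) {c : ℝ} (hc : 0 < c)
    (ξ : ℕ → Fin (2 * N) → ℝ) (ℓ n : ℕ) {x : ℝ} (hx : 0 ≤ x)
    (h : x < theta c ξ ℓ (n + 1) - theta c ξ ℓ n) :
    ∃ k : Fin (2 * N), c * x < ξ n k ∧ c * x < brw ξ n (parent k) - brwMax ξ (n - ℓ) := by
  set η : ℕ → Fin (2 * N) → ℝ := fun j i => c⁻¹ * ξ j i with hη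
  have hT : x < c⁻¹ * brwMax ξ (n + 1) - dsp η ℓ ((n : ℤ) + 1) - theta c ξ ℓ n := by
    rw [theta_succ] at h
    rcases max_cases (theta c ξ ℓ n) (c⁻¹ * brwMax ξ (n + 1) - dsp η ℓ ((n : ℤ) + 1)) with h' | h'
    · rw [h'.1] at h; linarith
    · rw [h'.1] at h; exact h
  rw [brwMax_eq_last hN, brw_succ] at hT
  set k := origin ξ n ⟨N - 1, by omega⟩
  have hR := dsp_succ η ℓ n
  have hR1 : dsp η ℓ n ≤ dsp η ℓ ((n : ℤ) + 1) := hR ▸ le_max_left _ _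
  have hR2 : dsp η ℓ ((n : ℤ) - ℓ) + c⁻¹ * ξ n k ≤ dsp η ℓ ((n : ℤ) + 1) := by
    rw [hR]
    exact (le_ciSup (f := fun k => dsp η ℓ ((n : ℤ) - ℓ) + η n k)
      (Set.finite_range _).bddAbove k).trans (le_max_right _ _)
  -- Before time `0` both processes stand still, so `n - ℓ` may be truncated at `0`.
  have hR3 : dsp η ℓ ((n : ℤ) - ℓ) = dsp η ℓ ((n - ℓ : ℕ) : ℤ) := by
    rcases le_total ℓ n with h' | h'
    · rw [Nat.cast_sub h']
    · rw [dsp_of_nonpos _ _ (by omega), dsp_of_nonpos _ _ (by omega)]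
  have h1 := le_theta c ξ ℓ (le_refl n)
  have h2 := le_theta c ξ ℓ (Nat.sub_le n ℓ)
  have h3 := mul_le_mul_of_nonneg_left (brw_le_brwMax ξ n (parent k)) (inv_pos.2 hc).le
  rw [← hη] at h1 h2
  refine ⟨k, ?_, ?_⟩
  · have : x < c⁻¹ * ξ n k := by linarith
    rwa [inv_mul_eq_div, lt_div_iff₀' hc] at this
  · have : x < c⁻¹ * (brw ξ n (parent k) - brwMax ξ (n - ℓ)) := by linarith
    rwa [inv_mul_eq_div, lt_div_iff₀' hc] at this

/-- A multiplicative-additive functional along the genealogies of the particles, started at time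
`s` from the value `w₀`: when a particle of weight `w` makes the jump `z`, its child has weight
`w * φ z + ψ z`. -/
noncomputable def weight {N : ℕ} (φ ψ : ℝ → ℝ≥0∞) (w₀ : ℝ≥0∞) (ξ : ℕ → Fin (2 * N) → ℝ) (s : ℕ) :
    ℕ → Fin N → ℝ≥0∞
  | 0 => fun _ => w₀
  | d + 1 => fun i =>
      weight φ ψ w₀ ξ s d (parent (origin ξ (s + d) i)) * φ (ξ (s + d) (origin ξ (s + d) i))
        + ψ (ξ (s + d) (origin ξ (s + d) i))

/-- The exponential weight of jumps up to `b`; larger jumps have weight `0`. The positive part of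
the jump is taken, so that for `l ≥ 0` the weight of a jump up to `b` is at least `1` whatever its
sign. -/
noncomputable def expWeight (l b z : ℝ) : ℝ≥0∞ :=
  (Set.Iic b).indicator (fun z => ENNReal.ofReal (Real.exp (l * max z 0))) z

/-- The indicator of a jump larger than `b`. -/
noncomputable def bigJump (b z : ℝ) : ℝ≥0∞ := (Set.Ioi b).indicator 1 z

theorem measurable_expWeight (l b : ℝ) : Measurable (expWeight l b) :=
  Measurable.indicator (by fun_prop) measurableSet_Iic

theorem measurable_bigJump (b : ℝ) : Measurable (bigJump b) :=
  measurable_one.indicator measurableSet_Ioi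

/-- With the weights `expWeight l b`, `bigJump b` and the initial value `exp (-l X)`, a particle has
weight at least `1` as soon as a jump larger than `b` occurs in its genealogy or it has climbed
by `X` above the front at time `s`. -/
theorem min_one_exp_le_weight {N : ℕ} {l : ℝ} (hl : 0 ≤ l) (b X : ℝ)
    (ξ : ℕ → Fin (2 * N) → ℝ) (s d : ℕ) (i : Fin N) :
    ENNReal.ofReal (min 1 (Real.exp (l * (brw ξ (s + d) i - brwMax ξ s - X)))) ≤
      weight (expWeight l b) (bigJump b) (ENNReal.ofReal (Real.exp (-(l * X)))) ξ s d i := by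
  induction d generalizing i with
  | zero =>
    refine ENNReal.ofReal_le_ofReal ((min_le_right _ _).trans (Real.exp_le_exp.2 ?_))
    have := mul_nonneg hl (sub_nonneg.2 (brw_le_brwMax ξ s i))
    rw [add_zero]
    linarith
  | succ d ih =>
    rw [← add_assoc, brw_succ]
    change _ ≤ weight _ _ _ ξ s d (parent (origin ξ (s + d) i)) *
      expWeight l b (ξ (s + d) (origin ξ (s + d) i)) + bigJump b (ξ (s + d) (origin ξ (s + d) i))
    set o := origin ξ (s + d) i
    by_cases hz : ξ (s + d) o ≤ b
    · have hφ : expWeight l b (ξ (s + d) o) =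
          ENNReal.ofReal (Real.exp (l * max (ξ (s + d) o) 0)) :=
        Set.indicator_of_mem (show ξ (s + d) o ∈ Set.Iic b from hz) _
      rw [hφ]
      refine le_trans ?_ (le_add_of_le_of_nonneg (mul_le_mul_left (ih (parent o)) _) zero_le)
      rw [← ENNReal.ofReal_mul (by positivity)]
      refine ENNReal.ofReal_le_ofReal ?_
      have h0 : 0 ≤ l * max (ξ (s + d) o) 0 := by positivity
      have h1 : l * ξ (s + d) o ≤ l * max (ξ (s + d) o) 0 := by gcongr; exact le_max_left _ _
      rw [min_mul_of_nonneg _ _ (Real.exp_pos _).le, ← Real.exp_add, one_mul]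
      refine min_le_min (Real.one_le_exp h0) (Real.exp_le_exp.2 ?_)
      linarith
    · have hb : bigJump b (ξ (s + d) o) = 1 := by
        rw [bigJump, Set.indicator_of_mem (by simpa using hz), Pi.one_apply]
      rw [hb]
      refine le_trans ?_ le_add_self
      exact (ENNReal.ofReal_le_ofReal (min_le_left _ _)).trans_eq ENNReal.ofReal_one

/-! ### Measurability -/

section Measurability

variable {Ω : Type*} [mΩ : MeasurableSpace Ω]

theorem measurable_tuple_sort {n : ℕ} {g : Fin n → Ω → ℝ} (hg : ∀ k, Measurable (g k))
    (i : Fin n) : Measurable fun ω => Tuple.sort (fun k => g k ω) i := by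
  have h : Measurable[_, ⊤] fun ω => Tuple.sort (fun k => g k ω) := by
    let : MeasurableSpace (Equiv.Perm (Fin n)) := ⊤
    refine measurable_to_countable' fun σ => ?_
    have : (fun ω => Tuple.sort fun k => g k ω) ⁻¹' {σ} =
        (⋂ (a) (b) (_ : a ≤ b), {ω | g (σ a) ω ≤ g (σ b) ω}) ∩
          ⋂ (a) (b) (_ : a < b), ({ω | g (σ a) ω = g (σ b) ω}ᶜ ∪ {_ω | σ a < σ b}) := by
      ext ω
      rw [Set.mem_preimage, Set.mem_singleton_iff, eq_comm, Tuple.eq_sort_iff]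
      simp only [Set.mem_inter_iff, Set.mem_iInter, Set.mem_union, Set.mem_compl_iff,
        Set.mem_ofPred_eq, ← imp_iff_not_or]
      rfl
    rw [this]
    refine .inter
      (.iInter fun a => .iInter fun b => .iInter fun _ => measurableSet_le (hg _) (hg _))
      (.iInter fun a => .iInter fun b => .iInter fun _ => ?_)
    exact (measurableSet_eq_fun (hg _) (hg _)).compl.union (.const _)
  let : MeasurableSpace (Equiv.Perm (Fin n)) := ⊤
  exact (measurable_from_top (f := fun σ : Equiv.Perm (Fin n) => σ i)).comp h

theorem measurable_eval {ι β : Type*} [Countable ι] [MeasurableSpace ι]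
    [MeasurableSingletonClass ι] [MeasurableSpace β] {u : ι → Ω → β} (hu : ∀ i, Measurable (u i))
    {f : Ω → ι} (hf : Measurable f) : Measurable fun ω => u (f ω) ω :=
  (measurable_from_prod_countable_right (f := fun p : ι × Ω => u p.1 p.2) hu).comp
    (hf.prodMk measurable_id)

variable {N : ℕ} {ξ : ℕ → Fin (2 * N) → Ω → ℝ} {n : ℕ}

theorem measurable_brw (hξ : ∀ t < n, ∀ k, Measurable (ξ t k)) (i : Fin N) :
    Measurable fun ω => brw (fun t k => ξ t k ω) n i := by
  induction n generalizing i with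
  | zero => exact measurable_const
  | succ n ih =>
    have hg : ∀ k, Measurable fun ω => brw (fun t k => ξ t k ω) n (parent k) + ξ n k ω := fun k =>
      (ih (fun t ht => hξ t (ht.trans n.lt_succ_self)) _).add (hξ n n.lt_succ_self k)
    exact measurable_eval hg (measurable_tuple_sort hg _)

theorem measurable_origin (hξ : ∀ t ≤ n, ∀ k, Measurable (ξ t k)) (i : Fin N) :
    Measurable fun ω => origin (fun t k => ξ t k ω) n i :=
  measurable_tuple_sort (fun k => (measurable_brw (fun t ht => hξ t ht.le) _).add
    (hξ n le_rfl k)) _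

theorem measurable_weight {φ ψ : ℝ → ℝ≥0∞} (hφ : Measurable φ) (hψ : Measurable ψ) (w₀ : ℝ≥0∞)
    {s d : ℕ} (hξ : ∀ t < s + d, ∀ k, Measurable (ξ t k)) (i : Fin N) :
    Measurable fun ω => weight φ ψ w₀ (fun t k => ξ t k ω) s d i := by
  induction d generalizing i with
  | zero => exact measurable_const
  | succ d ih =>
    have h := ih fun t ht => hξ t (by omega)
    exact measurable_eval (u := fun k ω => weight φ ψ w₀ (fun t k => ξ t k ω) s d (parent k) *
        φ (ξ (s + d) k ω) + ψ (ξ (s + d) k ω))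
      (fun k => ((h _).mul (hφ.comp (hξ _ (by omega) k))).add (hψ.comp (hξ _ (by omega) k)))
      (measurable_origin (fun t ht => hξ t (by omega)) i)

theorem measurable_dsp (hξ : ∀ t k, Measurable (ξ t k)) (ℓ n : ℕ) :
    Measurable fun ω => dsp (fun t k => ξ t k ω) ℓ n := by
  induction n using Nat.strong_induction_on with
  | _ n ih =>
    cases n with
    | zero => simp only [Nat.cast_zero, dsp_of_nonpos _ _ le_rfl, measurable_const]
    | succ n =>
      have h : Measurable fun ω => dsp (fun t k => ξ t k ω) ℓ ((n : ℤ) - ℓ) := by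
        rcases le_total ℓ n with h' | h'
        · simpa only [Nat.cast_sub h'] using ih (n - ℓ) (by omega)
        · simp only [dsp_of_nonpos _ _ (show (n : ℤ) - ℓ ≤ 0 by omega), measurable_const]
      simp only [Nat.cast_succ, dsp_succ]
      exact (ih n n.lt_succ_self).max (.iSup fun k => h.add (hξ n k))

theorem measurable_theta (hξ : ∀ t k, Measurable (ξ t k)) (c : ℝ) (ℓ n : ℕ) :
    Measurable fun ω => theta c (fun t k => ξ t k ω) ℓ n := by
  have hT : ∀ k : ℕ, Measurable fun ω => c⁻¹ * brwMax (fun t k => ξ t k ω) k -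
      dsp (fun j i => c⁻¹ * ξ j i ω) ℓ k := fun k =>
    (Measurable.const_mul (.iSup fun i => measurable_brw (fun t _ => hξ t) i) _).sub
      (measurable_dsp (ξ := fun j i ω => c⁻¹ * ξ j i ω) (fun t k => (hξ t k).const_mul _) ℓ k)
  induction n with
  | zero => simp only [theta_zero, measurable_const]
  | succ n ih =>
    simp only [theta_succ]
    have := hT (n + 1)
    push_cast at this
    exact ih.max this

end Measurability

/-! ### Regularly varying tails -/

section Tail

variable {ν : Measure ℝ} {α : ℝ}

theorem RegularlyVarying.tendsto_real_Ioi (h : RegularlyVarying (tailInv ν) α) {t : ℝ}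
    (ht : 0 < t) :
    Tendsto (fun x => ν.real (Set.Ioi (t * x)) / ν.real (Set.Ioi x)) atTop (𝓝 (t ^ (-α))) := by
  have := (h.2.2 t ht).inv₀ (Real.rpow_pos_of_pos ht α).ne'
  rw [← Real.rpow_neg ht.le] at this
  refine this.congr fun x => ?_
  simp only [tailInv, one_div, inv_div_inv, inv_div]

variable [IsProbabilityMeasure ν]

theorem antitone_real_Ioi : Antitone fun x => ν.real (Set.Ioi x) := fun _ _ h =>
  measureReal_mono (Set.Ioi_subset_Ioi h)

theorem RegularlyVarying.real_Ioi_pos (h : RegularlyVarying (tailInv ν) α) (x : ℝ) :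
    0 < ν.real (Set.Ioi x) := by
  obtain ⟨y, hy, hxy⟩ := (h.2.1.and (eventually_ge_atTop x)).exists
  exact (one_div_pos.1 hy).trans_le (antitone_real_Ioi hxy)

/-- Every `X > x₀` lies in a dyadic interval `(2 ^ k x₀, 2 ^ (k + 1) x₀]`. -/
theorem exists_dyadic {x₀ X : ℝ} (hx₀ : 0 < x₀) (hX : x₀ < X) :
    ∃ k : ℕ, 2 ^ k * x₀ < X ∧ X ≤ 2 ^ (k + 1) * x₀ := by
  have h1 : 1 < X / x₀ := (one_lt_div hx₀).2 hX
  obtain ⟨n, hn1, hn2⟩ := exists_mem_Ioc_zpow (zero_lt_one.trans h1) one_lt_two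
  have hn : 0 < n + 1 := (one_lt_zpow_iff_right₀ one_lt_two).1 (h1.trans_le hn2)
  lift n to ℕ using by omega
  exact ⟨n, (lt_div_iff₀ hx₀).1 (mod_cast hn1), (div_le_iff₀ hx₀).1 (mod_cast hn2)⟩

/-- A lower bound of Potter type for the tail. -/
theorem RegularlyVarying.exists_le_real_Ioi (h : RegularlyVarying (tailInv ν) α) (hα : 0 < α)
    {β : ℝ} (hβ : α < β) :
    ∃ C > 0, ∀ᶠ X in atTop, C * X ^ (-β) ≤ ν.real (Set.Ioi X) := by
  have hlim : (2 : ℝ) ^ (-β) < 2 ^ (-α) := Real.rpow_lt_rpow_of_exponent_lt one_lt_two (by linarith)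
  obtain ⟨a, ha⟩ := eventually_atTop.1
    ((h.tendsto_real_Ioi two_pos).eventually (eventually_ge_nhds hlim))
  set x₀ := max a 1
  have hx₀ : 0 < x₀ := lt_max_of_lt_right one_pos
  have hstep : ∀ k : ℕ, ((2 : ℝ) ^ k) ^ (-β) * ν.real (Set.Ioi x₀) ≤
      ν.real (Set.Ioi (2 ^ k * x₀)) := by
    intro k
    induction k with
    | zero => simp
    | succ k ih =>
      have h1 : a ≤ 2 ^ k * x₀ := (le_max_left a 1).trans
        (le_mul_of_one_le_left hx₀.le (one_le_pow₀ one_le_two))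
      have h2 := (le_div_iff₀ (h.real_Ioi_pos _)).1 (ha _ h1)
      rw [pow_succ', mul_assoc 2, Real.mul_rpow two_pos.le (by positivity), mul_assoc]
      exact (mul_le_mul_of_nonneg_left ih (by positivity)).trans h2
  refine ⟨(2 / x₀) ^ (-β) * ν.real (Set.Ioi x₀),
    mul_pos (Real.rpow_pos_of_pos (by positivity) _) (h.real_Ioi_pos _), ?_⟩
  filter_upwards [eventually_gt_atTop x₀] with X hX
  obtain ⟨k, hk1, hk2⟩ := exists_dyadic hx₀ hX
  have hX0 : 0 < X := hx₀.trans hX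
  refine le_trans ?_ ((hstep (k + 1)).trans (antitone_real_Ioi hk2))
  rw [mul_right_comm, ← Real.mul_rpow (by positivity) hX0.le]
  refine mul_le_mul_of_nonneg_right ?_ measureReal_nonneg
  refine Real.rpow_le_rpow_of_nonpos (by positivity) ?_ (by linarith)
  rw [pow_succ', div_mul_eq_mul_div, le_div_iff₀ hx₀]
  nlinarith

/-- An upper bound of Potter type for the tail along a geometric sequence. -/
theorem RegularlyVarying.exists_real_Ioi_le (h : RegularlyVarying (tailInv ν) α)
    {q : ℝ} (hq : q < α) :
    ∃ x₀ > 0, ∀ k : ℕ, ν.real (Set.Ioi (2 ^ k * x₀)) ≤ ((2 : ℝ) ^ (-q)) ^ k := by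
  have hlim : (2 : ℝ) ^ (-α) < 2 ^ (-q) := Real.rpow_lt_rpow_of_exponent_lt one_lt_two (by linarith)
  obtain ⟨a, ha⟩ := eventually_atTop.1
    ((h.tendsto_real_Ioi two_pos).eventually (eventually_le_nhds hlim))
  have hx₀ : 0 < max a 1 := lt_max_of_lt_right one_pos
  refine ⟨max a 1, hx₀, fun k => ?_⟩
  induction k with
  | zero => simp [measureReal_le_one]
  | succ k ih =>
    have h1 : a ≤ 2 ^ k * max a 1 := (le_max_left a 1).trans
      (le_mul_of_one_le_left hx₀.le (one_le_pow₀ one_le_two))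
    have h2 := (div_le_iff₀ (h.real_Ioi_pos _)).1 (ha _ h1)
    rw [pow_succ', mul_assoc 2, pow_succ']
    exact h2.trans (mul_le_mul_of_nonneg_left ih (by positivity))

/-- Moments of order smaller than the index of regular variation are finite. -/
theorem RegularlyVarying.lintegral_rpow_lt_top (h : RegularlyVarying (tailInv ν) α)
    {p : ℝ} (hp : 0 < p) (hpα : p < α) :
    ∫⁻ z, ENNReal.ofReal ((max z 0) ^ p) ∂ν < ∞ := by
  obtain ⟨q, hpq, hqα⟩ := exists_between hpα
  obtain ⟨x₀, hx₀, htail⟩ := h.exists_real_Ioi_le hqα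
  -- On the dyadic interval `(2 ^ k x₀, 2 ^ (k + 1) x₀]` the `p`-th power is at most
  -- `((2 x₀) ^ p) (2 ^ p) ^ k`.
  have hpt : ∀ z, ENNReal.ofReal ((max z 0) ^ p) ≤ ENNReal.ofReal (x₀ ^ p) +
      ∑' k : ℕ, (Set.Ioi (2 ^ k * x₀)).indicator
        (fun _ => ENNReal.ofReal ((2 * x₀) ^ p * (2 ^ p) ^ k)) z := by
    intro z
    rcases le_or_gt z x₀ with hz | hz
    · exact (ENNReal.ofReal_le_ofReal (Real.rpow_le_rpow (le_max_right _ _)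
        (max_le hz hx₀.le) hp.le)).trans le_self_add
    · have hz0 : 0 < z := hx₀.trans hz
      obtain ⟨k, hk1, hk2⟩ := exists_dyadic hx₀ hz
      refine le_trans ?_ (le_add_of_nonneg_of_le zero_le (ENNReal.le_tsum k))
      rw [Set.indicator_of_mem (by exact hk1), max_eq_left hz0.le]
      refine ENNReal.ofReal_le_ofReal ?_
      have h2 : ((2 : ℝ) ^ p) ^ k = ((2 : ℝ) ^ k) ^ p := by
        rw [← Real.rpow_natCast, ← Real.rpow_natCast, ← Real.rpow_mul two_pos.le,
          ← Real.rpow_mul two_pos.le, mul_comm]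
      rw [h2, ← Real.mul_rpow (by positivity) (by positivity)]
      refine Real.rpow_le_rpow hz0.le (hk2.trans_eq ?_) hp.le
      ring
  refine (lintegral_mono hpt).trans_lt ?_
  rw [lintegral_add_left measurable_const, lintegral_const, measure_univ, mul_one, lintegral_tsum
    fun k => (measurable_const.indicator measurableSet_Ioi).aemeasurable]
  refine ENNReal.add_lt_top.2 ⟨ENNReal.ofReal_lt_top, ?_⟩
  have hr0 : (0 : ℝ) ≤ 2 ^ (p - q) := by positivity
  have hr1 : (2 : ℝ) ^ (p - q) < 1 := Real.rpow_lt_one_of_one_lt_of_neg one_lt_two (by linarith)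
  refine (ENNReal.tsum_le_tsum (g := fun k : ℕ =>
    ENNReal.ofReal ((2 * x₀) ^ p * (2 ^ (p - q)) ^ k)) fun k => ?_).trans_lt ?_
  · rw [lintegral_indicator_const measurableSet_Ioi, ← ofReal_measureReal,
      ← ENNReal.ofReal_mul (by positivity)]
    refine ENNReal.ofReal_le_ofReal ((mul_le_mul_of_nonneg_left (htail k)
      (by positivity)).trans_eq ?_)
    rw [mul_assoc, ← mul_pow, ← Real.rpow_add two_pos, sub_eq_add_neg]
  · exact ((summable_geometric_of_lt_one hr0 hr1).mul_left _).tsum_ofReal_lt_top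

end Tail

/-! ### The exponential moment of the truncated jumps -/

section ExpMoment

variable {ν : Measure ℝ} [IsProbabilityMeasure ν] {α : ℝ}

theorem exp_le_one_add_rpow_mul {u p : ℝ} (hu : 0 ≤ u) (hp0 : 0 ≤ p) (hp1 : p ≤ 1) :
    Real.exp u ≤ 1 + u ^ p * Real.exp (2 * u) := by
  have h1 : u ≤ u ^ p * Real.exp u := by
    rcases le_total u 1 with h | h
    · have := Real.self_le_rpow_of_le_one hu h hp1
      nlinarith [Real.one_le_exp hu, Real.rpow_nonneg hu p]
    · have := Real.one_le_rpow h hp0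
      nlinarith [Real.add_one_le_exp u]
  have h2 : Real.exp u - 1 ≤ u * Real.exp u := by
    have := Real.add_one_le_exp (-u)
    have h3 : Real.exp (-u) * Real.exp u = 1 := by rw [← Real.exp_add]; simp
    nlinarith [Real.exp_pos u]
  rw [two_mul, Real.exp_add]
  nlinarith [Real.exp_pos u]

theorem lintegral_expWeight_le {l b p : ℝ} (hl : 0 ≤ l) (hp0 : 0 ≤ p) (hp1 : p ≤ 1) :
    ∫⁻ z, expWeight l b z ∂ν ≤ 1 + ENNReal.ofReal (l ^ p * Real.exp (2 * (l * b))) *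
      ∫⁻ z, ENNReal.ofReal ((max z 0) ^ p) ∂ν := by
  have hm : Measurable fun z : ℝ => ENNReal.ofReal ((max z 0) ^ p) := by fun_prop
  have : ∀ z, expWeight l b z ≤ 1 + ENNReal.ofReal (l ^ p * Real.exp (2 * (l * b))) *
      ENNReal.ofReal ((max z 0) ^ p) := by
    intro z
    by_cases hz : z ≤ b
    · have hφ : expWeight l b z = ENNReal.ofReal (Real.exp (l * max z 0)) :=
        Set.indicator_of_mem (show z ∈ Set.Iic b from hz) _
      rw [hφ, ← ENNReal.ofReal_mul (by positivity), ← ENNReal.ofReal_one,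
        ← ENNReal.ofReal_add zero_le_one (by positivity)]
      refine ENNReal.ofReal_le_ofReal ?_
      rcases le_total z 0 with h0 | h0
      · rw [max_eq_right h0, mul_zero, Real.exp_zero]
        exact le_add_of_nonneg_right (by positivity)
      · refine (exp_le_one_add_rpow_mul (by positivity) hp0 hp1).trans ?_
        rw [Real.mul_rpow hl (le_max_right _ _), max_eq_left h0, mul_right_comm]
        gcongr
    · have hφ : expWeight l b z = 0 :=
        Set.indicator_of_notMem (show z ∉ Set.Iic b from hz) _
      rw [hφ]
      exact zero_le
  refine (lintegral_mono this).trans_eq ?_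
  rw [lintegral_add_left measurable_const, lintegral_const_mul _ hm, lintegral_const, measure_univ,
    mul_one]

/-- For a displacement `X` which is large in terms of the number `m` of steps, some exponential
tilt `l` and truncation level `b` make the tilted truncated jumps essentially neutral over `m`
steps, while both `exp (-l X)` and the probability of a jump larger than `b` are at most of the
order of the probability of a jump larger than `X`. -/
theorem RegularlyVarying.exists_tilt (h : RegularlyVarying (tailInv ν) α) (hα : 0 < α)
    {ε : ℝ} (hε : 0 < ε) :
    ∃ m₀ : ℕ, 0 < m₀ ∧ ∀ m : ℕ, m₀ ≤ m → ∀ X : ℝ, (m : ℝ) ^ (max 1 α⁻¹ + ε) ≤ X →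
      ∃ l b : ℝ, 0 ≤ l ∧ ∫⁻ z, expWeight l b z ∂ν ≤ 1 + ENNReal.ofReal (1 / m) ∧
        3 * (Real.exp (-(l * X)) + 2 * ν.real (Set.Ioi b)) ≤ m * ν.real (Set.Ioi X) := by
  set κ := max 1 α⁻¹ + ε with hκ
  have hκ1 : 1 < κ := by linarith [le_max_left 1 α⁻¹]
  have hκα : α⁻¹ < κ := by linarith [le_max_right 1 α⁻¹]
  have hκ0 : 0 < κ := by linarith
  -- A moment of order `p` between `1 / κ` and `min 1 α` is used, with `l = A log X / X` and
  -- `b = δ X`, where `A > α` makes `exp (-l X) = X ^ (-A)` negligible against the tail, and `δ` is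
  -- so small that `exp (2 l b) = X ^ (2 A δ)` does not consume the gap `p - 1 / κ`.
  obtain ⟨p, hp1, hp2⟩ : ∃ p, κ⁻¹ < p ∧ p < min 1 α :=
    exists_between (lt_min (inv_lt_one_of_one_lt₀ hκ1) (inv_lt_of_inv_lt₀ hα hκα))
  have hp0 : 0 < p := (inv_pos.2 hκ0).trans hp1
  obtain ⟨hp3, hp4⟩ := lt_min_iff.1 hp2
  set A := α + 1
  have hA : 0 < A := by positivity
  set g := p - κ⁻¹ with hg
  have hg0 : 0 < g := sub_pos.2 hp1
  set δ := g / (4 * A) with hδ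
  have hδ0 : 0 < δ := by positivity
  set K := (∫⁻ z, ENNReal.ofReal ((max z 0) ^ p) ∂ν).toReal with hK
  have hKfin := (h.lintegral_rpow_lt_top hp0 hp4).ne
  have e1 : ∀ᶠ X : ℝ in atTop, X ^ (-A) ≤ ν.real (Set.Ioi X) := by
    obtain ⟨C, hC, hT⟩ := h.exists_le_real_Ioi hα (β := α + 1 / 2) (by linarith)
    have hs : ∀ᶠ X : ℝ in atTop, C⁻¹ ≤ X ^ (1 / 2 : ℝ) :=
      (tendsto_rpow_atTop (by norm_num)).eventually_ge_atTop _
    filter_upwards [hT, hs, eventually_gt_atTop 0] with X h1 h2 hX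
    refine le_trans ?_ h1
    have h3 : X ^ (-(α + 1 / 2)) = X ^ (1 / 2 : ℝ) * X ^ (-A) := by
      rw [← Real.rpow_add hX]; congr 1; simp only [A]; ring
    rw [h3, ← mul_assoc]
    refine le_mul_of_one_le_left (by positivity) ?_
    rwa [← inv_le_iff_one_le_mul₀' hC]
  have e2 : ∀ᶠ X : ℝ in atTop,
      ν.real (Set.Ioi (δ * X)) ≤ (δ ^ (-α) + 1) * ν.real (Set.Ioi X) := by
    filter_upwards [(h.tendsto_real_Ioi hδ0).eventually (eventually_le_nhds (lt_add_one _))]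
      with X hX
    exact (div_le_iff₀ (h.real_Ioi_pos _)).1 hX
  have e3 : ∀ᶠ X : ℝ in atTop, (A * Real.log X) ^ p * K ≤ X ^ (g / 2) := by
    have := ((isLittleO_log_rpow_rpow_atTop p (half_pos hg0)).def
      (c := (A ^ p * K + 1)⁻¹) (by positivity))
    filter_upwards [this, eventually_ge_atTop 1] with X h1 hX
    have hX0 : 0 < X := by linarith
    have hlog := Real.log_nonneg hX
    rw [Real.norm_of_nonneg (by positivity), Real.norm_of_nonneg (by positivity),
      inv_mul_eq_div, le_div_iff₀ (by positivity)] at h1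
    rw [Real.mul_rpow hA.le hlog]
    nlinarith [Real.rpow_nonneg hlog p]
  obtain ⟨X₀, hX₀⟩ := eventually_atTop.1 (e1.and (e2.and e3))
  obtain ⟨m₀, hm₀⟩ := exists_nat_ge (max (max X₀ 1) (3 * (1 + 2 * (δ ^ (-α) + 1))))
  have hm₀1 : (1 : ℝ) ≤ m₀ := (le_max_right X₀ 1).trans ((le_max_left _ _).trans hm₀)
  refine ⟨m₀, by exact_mod_cast hm₀1, fun m hm X hX => ?_⟩
  have hmm : (m₀ : ℝ) ≤ m := by exact_mod_cast hm
  have hm1 : (1 : ℝ) ≤ m := hm₀1.trans hmm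
  have hmX : (m : ℝ) ≤ X := (Real.self_le_rpow_of_one_le hm1 hκ1.le).trans hX
  have hX1 : 1 ≤ X := hm1.trans hmX
  have hX0 : 0 < X := by linarith
  have hlog := Real.log_nonneg hX1
  obtain ⟨f1, f2, f3⟩ := hX₀ X
    (((le_max_left X₀ 1).trans ((le_max_left _ _).trans hm₀)).trans (hmm.trans hmX))
  have hexp : ∀ a : ℝ, Real.exp (a * Real.log X) = X ^ a := fun a => by
    rw [Real.rpow_def_of_pos hX0, mul_comm]
  refine ⟨A * Real.log X / X, δ * X, by positivity, ?_, ?_⟩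
  · refine (lintegral_expWeight_le (by positivity) hp0.le hp3.le).trans ?_
    gcongr
    rw [← ENNReal.ofReal_toReal hKfin, ← hK, ← ENNReal.ofReal_mul (by positivity)]
    refine ENNReal.ofReal_le_ofReal ?_
    have h1 : 2 * (A * Real.log X / X * (δ * X)) = g / 2 * Real.log X := by
      rw [hδ]; field_simp; ring
    rw [h1, hexp, Real.div_rpow (by positivity) hX0.le]
    have h2 : (m : ℝ) ≤ X ^ κ⁻¹ :=
      (Real.le_rpow_inv_iff_of_pos (by positivity) hX0.le hκ0).2 hX
    have h3 : X ^ p = X ^ κ⁻¹ * (X ^ (g / 2) * X ^ (g / 2)) := by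
      rw [← Real.rpow_add hX0, ← Real.rpow_add hX0]; congr 1; rw [hg]; ring
    have h4 : 0 < X ^ (g / 2) := by positivity
    have h5 : 0 < X ^ κ⁻¹ := by positivity
    rw [h3]
    calc (A * Real.log X) ^ p / (X ^ κ⁻¹ * (X ^ (g / 2) * X ^ (g / 2))) * X ^ (g / 2) * K
        = ((A * Real.log X) ^ p * K) / X ^ (g / 2) / X ^ κ⁻¹ := by field_simp
      _ ≤ 1 / X ^ κ⁻¹ := by gcongr; exact (div_le_one h4).2 f3
      _ ≤ 1 / m := by gcongr
  · have h1 : -(A * Real.log X / X * X) = (-A) * Real.log X := by field_simp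
    rw [h1, hexp]
    have hT := h.real_Ioi_pos X
    have h2 : 3 * (1 + 2 * (δ ^ (-α) + 1)) ≤ (m : ℝ) := (le_max_right _ _).trans (hm₀.trans hmm)
    calc 3 * (X ^ (-A) + 2 * ν.real (Set.Ioi (δ * X)))
        ≤ 3 * (ν.real (Set.Ioi X) + 2 * ((δ ^ (-α) + 1) * ν.real (Set.Ioi X))) := by gcongr
      _ = 3 * (1 + 2 * (δ ^ (-α) + 1)) * ν.real (Set.Ioi X) := by ring
      _ ≤ m * ν.real (Set.Ioi X) := by gcongr

end ExpMoment

/-! ### Conditional first moments -/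

section FirstMoment

variable {Ω : Type*} {N : ℕ} {ξ : ℕ → Fin (2 * N) → Ω → ℝ}

theorem measurable_history {n : ℤ} {t : ℕ} (ht : (t : ℤ) ≤ n - 1) (k : Fin (2 * N)) :
    Measurable[history ξ n] (ξ t k) :=
  Measurable.mono (comap_measurable (ξ t k)) (le_iSup_of_le t (le_iSup_of_le ht
    (le_iSup (fun i => MeasurableSpace.comap (ξ t i) inferInstance) k))) le_rfl

theorem history_mono {n n' : ℤ} (h : n ≤ n') : history ξ n ≤ history ξ n' :=
  iSup_le fun t => iSup_le fun ht => iSup_le fun k =>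
    (measurable_history (ξ := ξ) (show (t : ℤ) ≤ n' - 1 by omega) k).comap_le

theorem history_const_mul {c : ℝ} (hc : c ≠ 0) (n : ℤ) :
    history (fun t k ω => c * ξ t k ω) n = history ξ n := by
  refine le_antisymm (iSup_le fun t => iSup_le fun ht => iSup_le fun k => ?_)
    (iSup_le fun t => iSup_le fun ht => iSup_le fun k => ?_)
  · exact ((measurable_history (ξ := ξ) ht k).const_mul c).comap_le
  · have := (measurable_history (ξ := fun t k ω => c * ξ t k ω) ht k).const_mul c⁻¹
    simp only [inv_mul_cancel_left₀ hc] at this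
    exact this.comap_le

variable [mΩ : MeasurableSpace Ω] {P : Measure Ω} {ν : Measure ℝ}

theorem lintegral_history_mul (hξ : ∀ t k, Measurable (ξ t k)) (hν : ∀ t k, P.map (ξ t k) = ν)
    (hind : iIndepFun (fun p : ℕ × Fin (2 * N) => ξ p.1 p.2) P) {n : ℕ} (k : Fin (2 * N))
    {f : Ω → ℝ≥0∞} (hf : Measurable[history ξ n] f) {g : ℝ → ℝ≥0∞} (hg : Measurable g) :
    ∫⁻ ω, f ω * g (ξ n k ω) ∂P = (∫⁻ ω, f ω ∂P) * ∫⁻ z, g z ∂ν := by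
  have h1 := indep_iSup_of_disjoint
    (fun p : ℕ × Fin (2 * N) => (hξ p.1 p.2).comap_le) hind
    (S := {p | p.1 < n}) (T := {(n, k)}) (by simp)
  have h2 : Indep (history ξ n) (MeasurableSpace.comap (ξ n k) inferInstance) P := by
    refine indep_of_indep_of_le_left (indep_of_indep_of_le_right h1 ?_) ?_
    · exact le_iSup₂_of_le (n, k) rfl le_rfl
    · exact iSup_le fun t => iSup_le fun ht => iSup_le fun i =>
        le_iSup₂_of_le (f := fun (p : ℕ × Fin (2 * N)) (_ : p ∈ {p : ℕ × Fin (2 * N) | p.1 < n}) =>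
          MeasurableSpace.comap (ξ p.1 p.2) inferInstance) (t, i) (show t < n by omega) le_rfl
  rw [← hν n k, lintegral_map hg (hξ n k)]
  exact lintegral_mul_eq_lintegral_mul_lintegral_of_independent_measurableSpace
    (history_le hξ n) (hξ n k).comap_le h2 hf (hg.comp (comap_measurable (ξ n k)))

/-- The expected total weight of the `N` particles on an event `B` of the past: in each step every
particle has two children, and selection only discards weight. -/
theorem lintegral_sum_weight_le (hξ : ∀ t k, Measurable (ξ t k))
    (hν : ∀ t k, P.map (ξ t k) = ν)
    (hind : iIndepFun (fun p : ℕ × Fin (2 * N) => ξ p.1 p.2) P) {φ ψ : ℝ → ℝ≥0∞}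
    (hφ : Measurable φ) (hψ : Measurable ψ) {w₀ M q : ℝ≥0∞} (hM : ∫⁻ z, φ z ∂ν ≤ M)
    (hM1 : 1 ≤ M) (hq : ∫⁻ z, ψ z ∂ν ≤ q) {s : ℕ} {B : Set Ω}
    (hB : MeasurableSet[history ξ s] B) (d : ℕ) :
    ∑ i, ∫⁻ ω, B.indicator (fun ω => weight φ ψ w₀ (fun t k => ξ t k ω) s d i) ω ∂P
      ≤ N * P B * (2 * M) ^ d * (w₀ + 2 * q) := by
  have hBm : ∀ n : ℕ, s ≤ n → MeasurableSet[history ξ n] B := fun n hn =>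
    history_mono (ξ := ξ) (by exact_mod_cast hn) _ hB
  have hBΩ : MeasurableSet B := history_le hξ s _ hB
  have hmeas : ∀ d i, Measurable[history ξ (s + d : ℕ)]
      (B.indicator (fun ω => weight φ ψ w₀ (fun t k => ξ t k ω) s d i)) := fun d i =>
    Measurable.indicator (measurable_weight (mΩ := history ξ (s + d : ℕ)) hφ hψ w₀
      (fun t ht k => measurable_history (by omega) k) i) (hBm _ (by omega))
  -- Carrying the total input `2 N q P(B)` of a step along closes the induction, as `2 M ≥ 2`.
  suffices h : ∑ i, ∫⁻ ω, B.indicator (fun ω => weight φ ψ w₀ (fun t k => ξ t k ω) s d i) ω ∂P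
      + 2 * N * P B * q ≤ N * P B * (2 * M) ^ d * (w₀ + 2 * q) from le_self_add.trans h
  induction d with
  | zero =>
    simp only [weight, lintegral_indicator_const hBΩ, Finset.sum_const, Finset.card_univ,
      Fintype.card_fin, nsmul_eq_mul, pow_zero]
    exact le_of_eq (by ring)
  | succ d ih =>
    set F : Fin N → Ω → ℝ≥0∞ := fun i =>
      B.indicator (fun ω => weight φ ψ w₀ (fun t k => ξ t k ω) s d i)
    set G : Fin (2 * N) → Ω → ℝ≥0∞ := fun k ω =>
      F (parent k) ω * φ (ξ (s + d) k ω) + B.indicator 1 ω * ψ (ξ (s + d) k ω)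
    have hG1 : Measurable[history ξ (s + d : ℕ)] (B.indicator (1 : Ω → ℝ≥0∞)) :=
      Measurable.indicator (@measurable_one _ _ _ (_) _) (hBm _ (by omega))
    have hGm : ∀ k, Measurable (G k) := fun k =>
      (((hmeas d (parent k)).mono (history_le hξ _) le_rfl).fun_mul (hφ.fun_comp (hξ _ k))).add
        ((hG1.mono (history_le hξ _) le_rfl).fun_mul (hψ.fun_comp (hξ _ k)))
    have hGi : ∀ k, ∫⁻ ω, G k ω ∂P ≤ (∫⁻ ω, F (parent k) ω ∂P) * M + P B * q := by
      intro k
      rw [lintegral_add_left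
        (((hmeas d (parent k)).mono (history_le hξ _) le_rfl).fun_mul (hφ.fun_comp (hξ _ k))),
        lintegral_history_mul hξ hν hind k (hmeas d _) hφ,
        lintegral_history_mul hξ hν hind k hG1 hψ, lintegral_indicator_one hBΩ]
      gcongr
    have hstep : ∀ ω, ∑ i, B.indicator
        (fun ω => weight φ ψ w₀ (fun t k => ξ t k ω) s (d + 1) i) ω ≤ ∑ k, G k ω := by
      intro ω
      by_cases hω : ω ∈ B
      · have : ∀ i, B.indicator (fun ω => weight φ ψ w₀ (fun t k => ξ t k ω) s (d + 1) i) ω =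
            G (origin (fun t k => ξ t k ω) (s + d) i) ω := fun i => by
          simp only [G, F, Set.indicator_of_mem hω, Pi.one_apply, one_mul]
          rfl
        simp only [this]
        exact (Finset.sum_map Finset.univ ⟨_, origin_injective _ _⟩ fun k => G k ω).symm.trans_le
          (Finset.sum_le_sum_of_subset (Finset.subset_univ _))
      · simp only [Set.indicator_of_notMem hω, Finset.sum_const_zero]
        exact zero_le
    have hsum : ∑ i, ∫⁻ ω, B.indicator
        (fun ω => weight φ ψ w₀ (fun t k => ξ t k ω) s (d + 1) i) ω ∂P ≤
        2 * M * (∑ i, ∫⁻ ω, F i ω ∂P) + 2 * N * P B * q := by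
      rw [← lintegral_finsetSum _ fun i _ => (hmeas _ i).mono (history_le hξ _) le_rfl]
      refine (lintegral_mono hstep).trans ?_
      rw [lintegral_finsetSum _ fun k _ => hGm k]
      refine (Finset.sum_le_sum fun k _ => hGi k).trans_eq ?_
      rw [Finset.sum_add_distrib, sum_comp_parent (fun i => (∫⁻ ω, F i ω ∂P) * M),
        ← Finset.sum_mul, Finset.sum_const, Finset.card_univ, Fintype.card_fin]
      simp only [nsmul_eq_mul]
      push_cast
      ring
    calc _ ≤ 2 * M * (∑ i, ∫⁻ ω, F i ω ∂P) + 2 * N * P B * q + 2 * N * P B * q := by gcongr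
      _ = 2 * M * (∑ i, ∫⁻ ω, F i ω ∂P) + 2 * 1 * (2 * N * P B * q) := by ring
      _ ≤ 2 * M * (∑ i, ∫⁻ ω, F i ω ∂P) + 2 * M * (2 * N * P B * q) := by gcongr
      _ = 2 * M * (∑ i, ∫⁻ ω, F i ω ∂P + 2 * N * P B * q) := by ring
      _ ≤ 2 * M * (N * P B * (2 * M) ^ d * (w₀ + 2 * q)) := by gcongr
      _ = _ := by ring

/-- On an event of the past, two large displacements are as unlikely as the expected total weight
indicates, the last jump being independent of the weights. -/
theorem measure_two_displacements_le (hξ : ∀ t k, Measurable (ξ t k))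
    (hν : ∀ t k, P.map (ξ t k) = ν)
    (hind : iIndepFun (fun p : ℕ × Fin (2 * N) => ξ p.1 p.2) P) {l b X : ℝ} (hl : 0 ≤ l)
    {M : ℝ≥0∞} (hM : ∫⁻ z, expWeight l b z ∂ν ≤ M) (hM1 : 1 ≤ M) (m n : ℕ) {B : Set Ω}
    (hB : MeasurableSet[history ξ ((n - m : ℕ) : ℤ)] B) :
    P ({ω | ∃ k : Fin (2 * N), X < ξ n k ω ∧
        X < brw (fun t k => ξ t k ω) n (parent k) - brwMax (fun t k => ξ t k ω) (n - m)} ∩ B) ≤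
      N * 2 ^ (m + 1) * M ^ m *
        (ENNReal.ofReal (Real.exp (-(l * X))) + 2 * ν (Set.Ioi b)) * ν (Set.Ioi X) * P B := by
  set s := n - m
  obtain ⟨d, hd⟩ : ∃ d, n = s + d := ⟨n - s, by omega⟩
  have hdm : d ≤ m := by omega
  set w₀ := ENNReal.ofReal (Real.exp (-(l * X)))
  set W : Fin N → Ω → ℝ≥0∞ := fun i => B.indicator
    (fun ω => weight (expWeight l b) (bigJump b) w₀ (fun t k => ξ t k ω) s d i)
  have hW : ∀ i, Measurable[history ξ n] (W i) := fun i =>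
    Measurable.indicator (measurable_weight (mΩ := history ξ n) (measurable_expWeight l b)
      (measurable_bigJump b) w₀ (fun t ht k => measurable_history (by omega) k) i)
      (history_mono (ξ := ξ) (by omega) _ hB)
  have hbig : ∀ a, ∫⁻ z, bigJump a z ∂ν = ν (Set.Ioi a) := fun a =>
    lintegral_indicator_one measurableSet_Ioi
  have hE := lintegral_sum_weight_le hξ hν hind (measurable_expWeight l b) (measurable_bigJump b)
    (w₀ := w₀) hM hM1 (hbig b).le hB d
  set E : Set Ω := _ ∩ B
  have hEG : E ⊆ {ω | 1 ≤ ∑ k : Fin (2 * N), W (parent k) ω * bigJump X (ξ n k ω)} := by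
    rintro ω ⟨⟨k, hk1, hk2⟩, hωB⟩
    refine le_trans ?_ (Finset.single_le_sum (f := fun k : Fin (2 * N) =>
      W (parent k) ω * bigJump X (ξ n k ω)) (fun _ _ => zero_le) (Finset.mem_univ k))
    have h1 : bigJump X (ξ n k ω) = 1 :=
      Set.indicator_of_mem (show ξ n k ω ∈ Set.Ioi X from hk1) _
    have h2 := min_one_exp_le_weight hl b X (fun t k => ξ t k ω) s d (parent k)
    rw [← hd, min_eq_left (Real.one_le_exp (mul_nonneg hl (by linarith))),
      ENNReal.ofReal_one] at h2
    simp only [h1, mul_one, W, Set.indicator_of_mem hωB]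
    exact h2
  have hWm : ∀ k, Measurable fun ω => W (parent k) ω * bigJump X (ξ n k ω) := fun k =>
    ((hW (parent k)).mono (history_le hξ _) le_rfl).fun_mul
      ((measurable_bigJump X).fun_comp (hξ n k))
  calc P E ≤ ∫⁻ ω, ∑ k : Fin (2 * N), W (parent k) ω * bigJump X (ξ n k ω) ∂P :=
        (measure_mono hEG).trans (by
          simpa only [one_mul] using
            mul_meas_ge_le_lintegral (μ := P) (Finset.measurable_sum _ fun k _ => hWm k) 1)
    _ = ∑ k : Fin (2 * N), (∫⁻ ω, W (parent k) ω ∂P) * ν (Set.Ioi X) := by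
        rw [lintegral_finsetSum _ fun k _ => hWm k]
        refine Finset.sum_congr rfl fun k _ => ?_
        rw [lintegral_history_mul hξ hν hind k (hW _) (measurable_bigJump X), hbig]
    _ = 2 * (∑ i, ∫⁻ ω, W i ω ∂P) * ν (Set.Ioi X) := by
        rw [sum_comp_parent (fun i => (∫⁻ ω, W i ω ∂P) * ν (Set.Ioi X)), ← Finset.sum_mul,
          nsmul_eq_mul]
        push_cast
        ring
    _ ≤ 2 * (N * P B * (2 * M) ^ m * (w₀ + 2 * ν (Set.Ioi b))) * ν (Set.Ioi X) := by
        gcongr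
        refine hE.trans ?_
        gcongr
        calc (1 : ℝ≥0∞) ≤ 1 * M := by rwa [one_mul]
          _ ≤ 2 * M := by gcongr; exact one_le_two
    _ = _ := by ring

/-- A conditional probability is at most `K` as soon as `P (E ∩ B) ≤ K P(B)` for all events `B` of
the conditioning `σ`-algebra. -/
theorem condProb_le_of_forall_measure_inter_le [IsProbabilityMeasure P] {𝓖 : MeasurableSpace Ω}
    (h𝓖 : 𝓖 ≤ mΩ) {E : Set Ω} (hE : MeasurableSet[mΩ] E) {K : ℝ}
    (h : ∀ B, MeasurableSet[𝓖] B → P.real (E ∩ B) ≤ K * P.real B) :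
    ∀ᵐ ω ∂P, (P⟦E | 𝓖⟧) ω ≤ K := by
  rw [ae_le_const_iff_forall_gt_measure_zero]
  intro a ha
  set B := {ω | a ≤ (P⟦E | 𝓖⟧) ω}
  have hB : MeasurableSet[𝓖] B :=
    @measurableSet_le _ _ _ _ _ 𝓖 _ _ _ _ _ (@measurable_const _ _ _ 𝓖 _)
      stronglyMeasurable_condExp.measurable
  have h1 : ∫ ω in B, (P⟦E | 𝓖⟧) ω ∂P = P.real (E ∩ B) := by
    rw [setIntegral_condExp h𝓖 ((integrable_const (1 : ℝ)).indicator hE) hB,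
      integral_indicator_const _ hE, smul_eq_mul, mul_one, measureReal_restrict_apply hE]
  have h2 : a * P.real B ≤ ∫ ω in B, (P⟦E | 𝓖⟧) ω ∂P := by
    refine setIntegral_ge_of_const_le_real (h𝓖 _ hB) (measure_ne_top _ _) (fun _ h => h)
      integrable_condExp.integrableOn
  have h3 := h B hB
  rw [← measureReal_eq_zero_iff]
  nlinarith [measureReal_nonneg (μ := P) (s := B)]

end FirstMoment

/-! ### The space scale, and the conclusion -/

theorem RegularlyVarying.eventually_scale_pos {ν : Measure ℝ} [IsProbabilityMeasure ν] {α : ℝ}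
    (h : RegularlyVarying (tailInv ν) α) :
    ∀ᶠ N : ℕ in atTop, 0 < scale ν N := by
  have hT : Tendsto (fun x => ν.real (Set.Ioi x)) atTop (𝓝 0) := by
    have := tendsto_measure_iInter_atTop (μ := ν) (s := fun x : ℝ => Set.Ioi x)
      (fun _ => measurableSet_Ioi.nullMeasurableSet) (fun _ _ h => Set.Ioi_subset_Ioi h)
      ⟨0, measure_ne_top _ _⟩
    have hempty : ⋂ x : ℝ, Set.Ioi x = ∅ :=
      Set.eq_empty_of_forall_notMem fun z hz => lt_irrefl z (Set.mem_iInter.1 hz z)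
    rw [hempty, measure_empty] at this
    exact (ENNReal.tendsto_toReal ENNReal.zero_ne_top).comp this
  have hlog : Tendsto (fun N : ℕ => Real.logb 2 N) atTop atTop :=
    (Real.tendsto_logb_atTop one_lt_two).comp tendsto_natCast_atTop_atTop
  filter_upwards [hlog.eventually_ge_atTop (tailInv ν 1), hlog.eventually_ge_atTop 0,
    eventually_ge_atTop 1] with N h1 h2 h3
  have hN : (1 : ℝ) ≤ N := by exact_mod_cast h3
  set y := 2 * (N : ℝ) * Real.logb 2 N
  have hy : tailInv ν 1 ≤ y := h1.trans (by simp only [y]; nlinarith)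
  have hmono : Monotone (tailInv ν) := fun a b hab =>
    one_div_le_one_div_of_le (h.real_Ioi_pos b) (antitone_real_Ioi hab)
  have hne : {x : ℝ | 0 ≤ x ∧ y < tailInv ν x}.Nonempty := by
    have hy1 : 0 < (|y| + 1)⁻¹ := by positivity
    obtain ⟨x, hx1, hx2⟩ := ((hT.eventually (gt_mem_nhds hy1)).and (eventually_ge_atTop 0)).exists
    refine ⟨x, hx2, ?_⟩
    have := (lt_inv_comm₀ (h.real_Ioi_pos x) (by positivity)).1 hx1
    rw [tailInv, one_div]
    linarith [le_abs_self y]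
  refine zero_lt_one.trans_le (le_csInf hne fun x hx => ?_)
  by_contra! hx1
  exact absurd hx.2 (not_lt.2 ((hmono hx1.le).trans hy))

theorem one_add_one_div_pow_le_three (m : ℕ) : (1 + 1 / (m : ℝ)) ^ m ≤ 3 := by
  rcases Nat.eq_zero_or_pos m with rfl | hm
  · norm_num
  have hm0 : (m : ℝ) ≠ 0 := by positivity
  calc (1 + 1 / (m : ℝ)) ^ m ≤ Real.exp (1 / m) ^ m := by
        gcongr; linarith [Real.add_one_le_exp (1 / (m : ℝ))]
    _ = Real.exp 1 := by rw [← Real.exp_nat_mul, mul_one_div_cancel hm0]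
    _ ≤ 3 := Real.exp_one_lt_three.le

end NBRW

theorem mainTheorem4 (ν : Measure ℝ) [IsProbabilityMeasure ν] (hν : ∀ᵐ x ∂ν, 0 ≤ x)
    (α : ℝ) (hα : 0 < α) (hreg : NBRW.RegularlyVarying (NBRW.tailInv ν) α) :
    ∀ ε : ℝ, 0 < ε → ∃ N₀ : ℕ, ∀ N : ℕ, N₀ ≤ N →
      ∀ (Ω : Type*) [MeasurableSpace Ω] (P : Measure Ω) [IsProbabilityMeasure P]
        (X : ℕ → Fin (2 * N) → Ω → ℝ),
        (∀ n i, Measurable (X n i)) →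
        (∀ n i, P.map (X n i) = ν) →
        iIndepFun (fun p : ℕ × Fin (2 * N) => X p.1 p.2) P →
        ∀ m : ℕ, (1 / 2 : ℝ) * Real.logb 2 N ≤ m → (m : ℝ) ≤ 2 * Real.logb 2 N →
        ∀ x : ℝ, (m : ℝ) ^ (max 1 α⁻¹ + ε) / NBRW.scale ν N ≤ x →
        ∀ n : ℕ, ∀ᵐ ω ∂P,
          (P⟦{ω' | x <
                NBRW.theta (NBRW.scale ν N) (fun k i => X k i ω') m (n + 1)
                  - NBRW.theta (NBRW.scale ν N) (fun k i => X k i ω') m n}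
            | NBRW.history (fun k i ω' => (NBRW.scale ν N)⁻¹ * X k i ω') ((n : ℤ) - m)⟧) ω
          ≤ N * m * 2 ^ (m + 1) / NBRW.tailInv ν (NBRW.scale ν N * x) ^ 2 := by
  intro ε hε
  obtain ⟨m₀, hm₀, htilt⟩ := hreg.exists_tilt hα hε
  have hlog : Tendsto (fun N : ℕ => 1 / 2 * Real.logb 2 N) atTop atTop :=
    ((Real.tendsto_logb_atTop one_lt_two).comp tendsto_natCast_atTop_atTop).const_mul_atTop
      one_half_pos
  obtain ⟨N₀, hN₀⟩ := eventually_atTop.1 (hreg.eventually_scale_pos.and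
    ((hlog.eventually_ge_atTop (m₀ : ℝ)).and (eventually_gt_atTop 0)))
  refine ⟨N₀, fun N hN Ω _ P _ X hX hlaw hind m hm _ x hx n => ?_⟩
  obtain ⟨hc, hmN, hN0⟩ := hN₀ N hN
  set c := NBRW.scale ν N
  rw [div_le_iff₀' hc] at hx
  have hm' : m₀ ≤ m := by exact_mod_cast hmN.trans hm
  have hm0 : 0 < m := hm₀.trans_le hm'
  have hx0 : 0 < c * x := lt_of_lt_of_le (by positivity) hx
  have hx1 : 0 < x := (mul_pos_iff_of_pos_left hc).1 hx0
  obtain ⟨l, b, hl, hφ, htail⟩ := htilt m hm' (c * x) hx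
  set E : Set Ω := {ω' | x < NBRW.theta c (fun k i => X k i ω') m (n + 1)
    - NBRW.theta c (fun k i => X k i ω') m n}
  have hE : MeasurableSet E := measurableSet_lt measurable_const
    ((NBRW.measurable_theta hX c m (n + 1)).fun_sub (NBRW.measurable_theta hX c m n))
  refine NBRW.condProb_le_of_forall_measure_inter_le
    (NBRW.history_le (fun k i => (hX k i).const_mul _) _)
    hE fun B hB => ?_
  have hB' : MeasurableSet[NBRW.history X ((n - m : ℕ) : ℤ)] B := by
    rw [NBRW.history_const_mul (inv_ne_zero hc.ne')] at hB
    exact NBRW.history_mono (ξ := X) (by omega) _ hB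
  have hmain := NBRW.measure_two_displacements_le hX hlaw hind (X := c * x) hl hφ le_self_add m n
    hB'
  have hbound : P (E ∩ B) ≤ _ := (measure_mono (Set.inter_subset_inter_left B fun ω hω =>
    NBRW.exists_two_displacements hN0 hc (fun k i => X k i ω) m n hx1.le hω)).trans hmain
  rw [← ENNReal.ofReal_one, ← ENNReal.ofReal_add zero_le_one (by positivity),
    ← ENNReal.ofReal_pow (by positivity), ← ofReal_measureReal (μ := ν) (s := Set.Ioi (c * x)),
    ← ofReal_measureReal (μ := ν) (s := Set.Ioi b), ← ofReal_measureReal (μ := P) (s := B),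
    ← ENNReal.ofReal_natCast N, ← ENNReal.ofReal_ofNat 2, ← ENNReal.ofReal_pow two_pos.le,
    ← ENNReal.ofReal_mul (by positivity), ← ENNReal.ofReal_mul (by positivity),
    ← ENNReal.ofReal_mul (by positivity), ← ENNReal.ofReal_add (by positivity) (by positivity),
    ← ENNReal.ofReal_mul (by positivity), ← ENNReal.ofReal_mul (by positivity),
    ← ENNReal.ofReal_mul (by positivity)] at hbound
  refine (ENNReal.toReal_le_of_le_ofReal (by positivity) hbound).trans ?_
  refine mul_le_mul_of_nonneg_right ?_ measureReal_nonneg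
  rw [NBRW.tailInv, one_div_pow, div_div_eq_mul_div, div_one]
  set T := ν.real (Set.Ioi (c * x))
  have hT : 0 ≤ T := measureReal_nonneg
  calc (N : ℝ) * 2 ^ (m + 1) * (1 + 1 / (m : ℝ)) ^ m *
        (Real.exp (-(l * (c * x))) + 2 * ν.real (Set.Ioi b)) * T
      ≤ (N : ℝ) * 2 ^ (m + 1) * 3 *
        (Real.exp (-(l * (c * x))) + 2 * ν.real (Set.Ioi b)) * T := by
        gcongr; exact NBRW.one_add_one_div_pow_le_three m
    _ = (N : ℝ) * 2 ^ (m + 1) *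
        (3 * (Real.exp (-(l * (c * x))) + 2 * ν.real (Set.Ioi b))) * T := by ring
    _ ≤ (N : ℝ) * 2 ^ (m + 1) * (m * T) * T := by gcongr
    _ = N * m * 2 ^ (m + 1) * T ^ 2 := by ring
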